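/- **Setting.** Consider a class of $d$-dimensional source manifolds (manifolds carrying sources, identified up to source- and label-preserving diffeomorphism) consisting of: a collection of boundaries $B$, closed under disjoint union $\sqcup$; the space $X$ of closed source manifolds, with disjoint union and complex conjugation $M\mapsto M^*$; and, for boundaries $A,B$, the space $Y_{A\sqcup B}$ of rimmed source manifolds with left boundary $A$ and right boundary $B$. The following operations on these are available: sewing $Y_{A\sqcup B}\times Y_{B\sqcup C}\to Y_{A\sqcup C}$, $(a,b)\mapsto ab$; closing $Y_{A\sqcup A}\to X$, $a\mapsto M(a)$ (sew the two copies of $A$ together); disjoint union; interchange of the labels of two parts of the left or of the right boundary; the involution $\star:Y_{A\sqcup B}\to Y_{B\sqcup A}$ (conjugate the sources and interchange left and right); and cylinders $C_\varepsilon=C_\varepsilon^\star\in Y_{B\sqcup B}$ of length $\varepsilon>0$ with $C_\varepsilon C_\delta=C_{\varepsilon+\delta}$. "Rimmed" means that every $a\in Y_{A\sqcup B}$ can be written as $a=C_\varepsilon a'$ and as $a=a''C_\delta$ for some $\varepsilon,\delta>0$ and $a',a''\in Y_{A\sqcup B}$. These operations satisfy the elementary identities of sewing: on $X$, $\sqcup$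 is commutative and associative and $*$ is an involution compatible with $\sqcup$; $(ab)c=a(bc)$; $M(ab)=M(ba)$; $a^{\star\star}=a$; $(ab)^\star=b^\star a^\star$; $M(a^\star)=M(a)^*$; $(a\sqcup a')(b\sqcup b')=ab\sqcup a'b'$; $(a\sqcup b)^\star=a^\star\sqcup b^\star$; $M(a\sqcup b)=M(a)\sqcup M(b)$. Writing $\sigma_L,\sigma_R$ for the interchange of the two parts of the left, respectively right, boundary: $\sigma_L\sigma_L a=a$; $(\sigma_L a)^\star=\sigma_R(a^\star)$; $a(\sigma_R b)=\sigma_R(ab)$; $(\sigma_R a)(\sigma_L b)=ab$; $\sigma_L(a\sqcup b)=\sigma_R(b\sqcup a)$; and $M(\sigma_R(a\sqcup b))=M(ab)$ for $a\in Y_{A\sqcup B}$, $b\in Y_{B\sqcup A}$ (sewing $a$ and $b$ crosswise is concatenating and closing). A path integral is a function $\zeta:X\to\mathbb C$ (finiteness) satisfying * reality: $\overline{\zeta(M)}=\zeta(M^*)$; * reflection positivity: $\sum_{I,J=1}^n\overline{\gamma_I}\gamma_J\,\zeta(M(N_I^\star N_J))$ is a non-negative real number for all $\gamma_I\in\mathbb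 C$, $N_I\in Y_{A\sqcup B}$; * continuity: for each boundary $B$ and $N\in Y_{B\sqcup B}$, $\zeta(M(C_\varepsilon N))$ is continuous in $\varepsilon\in(0,\infty)$; * factorization: $\zeta(M_1\sqcup M_2)=\zeta(M_1)\zeta(M_2)$. Let $H_{A\sqcup B}$ be the space of finite formal complex linear combinations of elements of $Y_{A\sqcup B}$, with all operations extended (bi)linearly and $\star$ antilinearly, and with the positive semidefinite sesquilinear form extending $\langle a|b\rangle=\zeta(M(a^\star b))$. Let $\mathcal D_{A\sqcup B}$ be its quotient by null vectors and $\mathcal H_{A\sqcup B}$ the Hilbert space completion; $|a\rangle\in\mathcal D_{A\sqcup B}$ denotes the class of $a\in H_{A\sqcup B}$. The map $|a\rangle\mapsto|a^\star\rangle$ is well defined and norm preserving and extends to a continuous antilinear map $\star:\mathcal H_{A\sqcup B}\to\mathcal H_{B\sqcup A}$. For $a\in H_{B_1\sqcup B_2}$ and any boundary $B$, right gluing $|b\rangle\mapsto|ba\rangle$ and left gluing $|b\rangle\mapsto|ab\rangle$ define bounded operators $\hat a_R:\mathcal H_{B\sqcup B_1}\to\mathcal H_{B\sqcup B_2}$ and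 $\hat a_L:\mathcal H_{B_2\sqcup B}\to\mathcal H_{B_1\sqcup B}$. Let $\mathcal A_L^{B\sqcup B}$ and $\mathcal A_R^{B\sqcup B}$ be the closures in the weak operator topology on $\mathcal B(\mathcal H_{B\sqcup B})$ of $\{\hat a_L: a\in H_{B\sqcup B}\}$ and $\{\hat a_R: a\in H_{B\sqcup B}\}$, respectively. **Theorem.** Let $\zeta$ be a path integral as above. (0) For all boundaries $B,B'$ and every $d\in\mathcal A_L^{B\sqcup B}$ there is exactly one bounded operator $\Phi^L_{BB'}(d)$ on $\mathcal H_{B\sqcup B'}$ with $\Phi^L_{BB'}(d)\,|C_\varepsilon\chi\rangle=\hat\chi_R\,d\,|C_\varepsilon\rangle$ for all $\varepsilon>0$ and $\chi\in H_{B\sqcup B'}$. Likewise, for every $d\in\mathcal A_R^{B'\sqcup B'}$ there is exactly one bounded operator $\Phi^R_{BB'}(d)$ on $\mathcal H_{B\sqcup B'}$ with $\Phi^R_{BB'}(d)\,|\chi C_\varepsilon\rangle=\hat\chi_L\,d\,|C_\varepsilon\rangle$ for all $\varepsilon>0$ and $\chi\in H_{B\sqcup B'}$. (1) For all boundaries $B,B_1,B_2$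 there is exactly one map $\Psi_R^{B,B_1\to B_2}:\mathcal H_{B_1\sqcup B_2}\to\mathcal B(\mathcal H_{B\sqcup B_1},\mathcal H_{B\sqcup B_2})$ that is continuous from the norm topology to the strong operator topology and satisfies $\Psi_R^{B,B_1\to B_2}(|a\rangle)\,|b\rangle=|ba\rangle$ for all $a\in H_{B_1\sqcup B_2}$ and $b\in H_{B\sqcup B_1}$. Writing $\hat a_R=\Psi_R^{B,B_1\to B_2}(|a\rangle)$ for $|a\rangle\in\mathcal H_{B_1\sqcup B_2}$, it satisfies $\Phi^L_{BB_2}(d)\,\hat a_R=\hat a_R\,\Phi^L_{BB_1}(d)$ for all $d\in\mathcal A_L^{B\sqcup B}$ and all $|a\rangle\in\mathcal H_{B_1\sqcup B_2}$. (2) Correspondingly, there is exactly one map $\Psi_L^{B_2\to B_1,B}:\mathcal H_{B_1\sqcup B_2}\to\mathcal B(\mathcal H_{B_2\sqcup B},\mathcal H_{B_1\sqcup B})$ that is continuous from the norm topology to the strong operator topology and satisfies $\Psi_L^{B_2\to B_1,B}(|a\rangle)\,|b\rangle=|ab\rangle$ for all $a\in H_{B_1\sqcup B_2}$ and $b\in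 H_{B_2\sqcup B}$. Writing $\hat a_L=\Psi_L^{B_2\to B_1,B}(|a\rangle)$, it satisfies $\Phi^R_{B_1B}(d)\,\hat a_L=\hat a_L\,\Phi^R_{B_2B}(d)$ for all $d\in\mathcal A_R^{B\sqcup B}$ and all $|a\rangle\in\mathcal H_{B_1\sqcup B_2}$. (3) For all $|a\rangle\in\mathcal H_{B_1\sqcup B_2}$, $\Psi_R^{B,B_2\to B_1}(|a^\star\rangle)=\big(\Psi_R^{B,B_1\to B_2}(|a\rangle)\big)^\dagger$ and $\Psi_L^{B_1\to B_2,B}(|a^\star\rangle)=\big(\Psi_L^{B_2\to B_1,B}(|a\rangle)\big)^\dagger$. -/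

import Mathlib

open scoped ComplexConjugate

set_option linter.checkUnivs false

/-- A sewing calculus of source manifolds.  `Bd` is the collection of boundaries; `X` is the space
of closed source manifolds; `Y A B` is the space of rimmed source manifolds with boundary whose
boundary is `A ⊔ B`, partitioned into a left boundary `A` and a right boundary `B`.
Source manifolds are identified when they are related by a diffeomorphism that preserves the
sources and the labelling of the boundary, so that the rules below, each of which says that two
ways to assemble a manifold give the same manifold, are equations.  (The dimension, the kind of
sources and local restrictions on them are arbitrary; the empty boundary is allowed in `Bd`.) -/
structure SourceManifolds where
  /-- boundaries (compact closed manifolds with sources that admit cylinders) -/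
  Bd : Type*
  /-- closed source manifolds -/
  X : Type*
  /-- rimmed source manifolds with left and right boundary -/
  Y : Bd → Bd → Type*
  /-- disjoint union of boundaries -/
  bdUnion : Bd → Bd → Bd
  /-- complex conjugation of the sources (with reflection) of a closed source manifold -/
  xConj : X → X
  /-- disjoint union of closed source manifolds -/
  xUnion : X → X → X
  /-- sew the right boundary of the first manifold to the left boundary of the second -/
  glue : ∀ {A B C : Bd}, Y A B → Y B C → Y A C
  /-- sew the right boundary to the left boundary, giving a closed manifold -/
  close : ∀ {A : Bd}, Y A A → X
  /-- complex conjugate the sources and interchange the labels left and right -/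
  star : ∀ {A B : Bd}, Y A B → Y B A
  /-- disjoint union of manifolds with boundary -/
  par : ∀ {A B A' B' : Bd}, Y A B → Y A' B' → Y (bdUnion A A') (bdUnion B B')
  /-- relabel the two parts of the left boundary -/
  swapL : ∀ {A A' B : Bd}, Y (bdUnion A A') B → Y (bdUnion A' A) B
  /-- relabel the two parts of the right boundary -/
  swapR : ∀ {A B B' : Bd}, Y A (bdUnion B B') → Y A (bdUnion B' B)
  /-- the cylinder `B × [0, ε]`, of length `ε > 0` -/
  cyl : ∀ B : Bd, {ε : ℝ // 0 < ε} → Y B B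
  xConj_xConj : ∀ M : X, xConj (xConj M) = M
  xUnion_comm : ∀ M N : X, xUnion M N = xUnion N M
  xUnion_assoc : ∀ M N K : X, xUnion (xUnion M N) K = xUnion M (xUnion N K)
  xConj_xUnion : ∀ M N : X, xConj (xUnion M N) = xUnion (xConj M) (xConj N)
  glue_assoc : ∀ {A B C D : Bd} (a : Y A B) (b : Y B C) (c : Y C D),
    glue (glue a b) c = glue a (glue b c)
  close_glue_comm : ∀ {A B : Bd} (a : Y A B) (b : Y B A), close (glue a b) = close (glue b a)
  star_star : ∀ {A B : Bd} (a : Y A B), star (star a) = a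
  star_glue : ∀ {A B C : Bd} (a : Y A B) (b : Y B C), star (glue a b) = glue (star b) (star a)
  close_star : ∀ {A : Bd} (a : Y A A), close (star a) = xConj (close a)
  par_glue : ∀ {A B C A' B' C' : Bd} (a : Y A B) (b : Y B C) (a' : Y A' B') (b' : Y B' C'),
    glue (par a a') (par b b') = par (glue a b) (glue a' b')
  star_par : ∀ {A B A' B' : Bd} (a : Y A B) (b : Y A' B'), star (par a b) = par (star a) (star b)
  close_par : ∀ {A B : Bd} (a : Y A A) (b : Y B B), close (par a b) = xUnion (close a) (close b)
  swapL_swapL : ∀ {A A' B : Bd} (a : Y (bdUnion A A') B), swapL (swapL a) = a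
  star_swapL : ∀ {A A' B : Bd} (a : Y (bdUnion A A') B), star (swapL a) = swapR (star a)
  /-- relabelling a part of the boundary that is not sewn can be done after sewing -/
  glue_swapR : ∀ {A B C C' : Bd} (a : Y A B) (b : Y B (bdUnion C C')),
    glue a (swapR b) = swapR (glue a b)
  /-- relabelling both sides of a seam changes nothing -/
  glue_swapR_swapL : ∀ {A B B' C : Bd} (a : Y A (bdUnion B B')) (b : Y (bdUnion B B') C),
    glue (swapR a) (swapL b) = glue a b
  /-- the disjoint union does not depend on the order, up to the labels on the boundary -/
  swapL_par : ∀ {A B A' B' : Bd} (a : Y A B) (b : Y A' B'), swapL (par a b) = swapR (par b a)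
  /-- sewing the two boundaries of `a` crosswise to those of `b` is concatenating and closing -/
  close_swapR_par : ∀ {A B : Bd} (a : Y A B) (b : Y B A),
    close (swapR (par a b)) = close (glue a b)
  glue_cyl_cyl : ∀ (B : Bd) (ε δ : {ε : ℝ // 0 < ε}),
    glue (cyl B ε) (cyl B δ) = cyl B ⟨ε.1 + δ.1, add_pos ε.2 δ.2⟩
  star_cyl : ∀ (B : Bd) (ε : {ε : ℝ // 0 < ε}), star (cyl B ε) = cyl B ε
  /-- manifolds in `Y A B` have a rim at the left boundary -/
  rimL : ∀ {A B : Bd} (a : Y A B), ∃ (ε : {ε : ℝ // 0 < ε}) (a' : Y A B), a = glue (cyl A ε) a'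
  /-- manifolds in `Y A B` have a rim at the right boundary -/
  rimR : ∀ {A B : Bd} (a : Y A B), ∃ (ε : {ε : ℝ // 0 < ε}) (a' : Y A B), a = glue a' (cyl B ε)

/-- A Euclidean path integral on source manifolds: a complex number `ζ M` for every closed source
manifold `M` (finiteness), subject to reality, reflection positivity, continuity and
factorization. -/
structure PathIntegral (S : SourceManifolds) where
  ζ : S.X → ℂ
  reality : ∀ M : S.X, conj (ζ M) = ζ (S.xConj M)
  reflection_positivity : ∀ {A B : S.Bd} (n : ℕ) (γ : Fin n → ℂ) (N : Fin n → S.Y A B),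
    ∃ r : ℝ, 0 ≤ r ∧
      ∑ i, ∑ j, conj (γ i) * γ j * ζ (S.close (S.glue (S.star (N i)) (N j))) = (r : ℂ)
  continuity : ∀ (B : S.Bd) (N : S.Y B B),
    Continuous fun ε : {ε : ℝ // 0 < ε} => ζ (S.close (S.glue (S.cyl B ε) N))
  factorization : ∀ M N : S.X, ζ (S.xUnion M N) = ζ M * ζ N

namespace SourceManifolds

variable (S : SourceManifolds)

/-- Formal finite complex linear combinations of rimmed source manifolds. -/
abbrev Lin (A B : S.Bd) : Type _ := S.Y A B →₀ ℂ

variable {S}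

/-- Bilinear extension of an operation on source manifolds. -/
noncomputable def lift₂ {α β γ : Type*} (f : α → β → γ) : (α →₀ ℂ) →ₗ[ℂ] (β →₀ ℂ) →ₗ[ℂ] (γ →₀ ℂ) :=
  Finsupp.lsum ℂ fun a => LinearMap.toSpanSingleton ℂ _ (Finsupp.lmapDomain ℂ ℂ (f a))

theorem lift₂_single {α β γ : Type*} (f : α → β → γ) (a : α) (b : β) (r s : ℂ) :
    lift₂ f (Finsupp.single a r) (Finsupp.single b s) = Finsupp.single (f a b) (r * s) := by
  simp [lift₂, Finsupp.lmapDomain_apply, Finsupp.mapDomain_single, Finsupp.smul_single]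

/-- Sewing, extended to linear combinations: the concatenation `ab`. -/
noncomputable def glueF {A B C : S.Bd} : S.Lin A B →ₗ[ℂ] S.Lin B C →ₗ[ℂ] S.Lin A C := lift₂ S.glue

/-- Disjoint union, extended to linear combinations. -/
noncomputable def parF {A B A' B' : S.Bd} :
    S.Lin A B →ₗ[ℂ] S.Lin A' B' →ₗ[ℂ] S.Lin (S.bdUnion A A') (S.bdUnion B B') := lift₂ S.par

/-- The relabelling of the left boundary, extended to linear combinations. -/
noncomputable def swapLF {A A' B : S.Bd} :
    S.Lin (S.bdUnion A A') B →ₗ[ℂ] S.Lin (S.bdUnion A' A) B := Finsupp.lmapDomain ℂ ℂ S.swapL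

/-- The antilinear extension of `⋆` to linear combinations. -/
noncomputable def starF {A B : S.Bd} : S.Lin A B →ₛₗ[starRingEnd ℂ] S.Lin B A where
  toFun a := (Finsupp.mapRange conj (map_zero _) a).mapDomain S.star
  map_add' a b := by
    rw [Finsupp.mapRange_add (fun x y => map_add _ x y), Finsupp.mapDomain_add]
  map_smul' c a := by
    rw [← Finsupp.mapDomain_smul]
    congr 1
    ext x
    simp

theorem starF_single {A B : S.Bd} (a : S.Y A B) (r : ℂ) :
    starF (Finsupp.single a r) = Finsupp.single (S.star a) (conj r) := by
  simp [starF, Finsupp.mapDomain_single]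

theorem glueF_single {A B C : S.Bd} (a : S.Y A B) (b : S.Y B C) (r s : ℂ) :
    glueF (Finsupp.single a r) (Finsupp.single b s) = Finsupp.single (S.glue a b) (r * s) :=
  lift₂_single _ _ _ _ _

theorem parF_single {A B A' B' : S.Bd} (a : S.Y A B) (b : S.Y A' B') (r s : ℂ) :
    parF (Finsupp.single a r) (Finsupp.single b s) = Finsupp.single (S.par a b) (r * s) :=
  lift₂_single _ _ _ _ _

theorem swapLF_single {A A' B : S.Bd} (a : S.Y (S.bdUnion A A') B) (r : ℂ) :
    swapLF (Finsupp.single a r) = Finsupp.single (S.swapL a) r := by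
  simp [swapLF, Finsupp.lmapDomain_apply, Finsupp.mapDomain_single]

theorem glueF_assoc {A B C D : S.Bd} (a : S.Lin A B) (b : S.Lin B C) (c : S.Lin C D) :
    glueF (glueF a b) c = glueF a (glueF b c) := by
  induction a using Finsupp.induction_linear with
  | zero => simp
  | add f g hf hg => simp only [map_add, LinearMap.add_apply, hf, hg]
  | single a r =>
    induction b using Finsupp.induction_linear with
    | zero => simp
    | add f g hf hg => simp only [map_add, LinearMap.add_apply, hf, hg]
    | single b s =>
      induction c using Finsupp.induction_linear with
      | zero => simp
      | add f g hf hg => simp only [map_add, hf, hg]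
      | single c t => simp only [glueF_single, S.glue_assoc, mul_assoc]

theorem starF_starF {A B : S.Bd} (a : S.Lin A B) : starF (starF a) = a := by
  induction a using Finsupp.induction_linear with
  | zero => simp
  | add f g hf hg => simp only [map_add, hf, hg]
  | single a r => simp [starF_single, S.star_star]

theorem starF_glueF {A B C : S.Bd} (a : S.Lin A B) (b : S.Lin B C) :
    starF (glueF a b) = glueF (starF b) (starF a) := by
  induction a using Finsupp.induction_linear with
  | zero => simp
  | add f g hf hg => simp only [map_add, LinearMap.add_apply, hf, hg]
  | single a r =>
    induction b using Finsupp.induction_linear with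
    | zero => simp
    | add f g hf hg => simp only [map_add, LinearMap.add_apply, hf, hg]
    | single b s => simp only [glueF_single, starF_single, S.star_glue, map_mul, mul_comm]

theorem starF_swapLF_glueF {A A' B : S.Bd} (a b : S.Lin (S.bdUnion A A') B) :
    glueF (starF (swapLF a)) (swapLF b) = glueF (starF a) b := by
  induction a using Finsupp.induction_linear with
  | zero => simp
  | add f g hf hg => simp only [map_add, LinearMap.add_apply, hf, hg]
  | single a r =>
    induction b using Finsupp.induction_linear with
    | zero => simp
    | add f g hf hg => simp only [map_add, hf, hg]
    | single b s => simp only [glueF_single, starF_single, swapLF_single, S.star_swapL, S.glue_swapR_swapL]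

end SourceManifolds

namespace PathIntegral

open SourceManifolds

variable {S : SourceManifolds} (P : PathIntegral S)

/-- The trace: sew the two copies of `A` together and evaluate the path integral. -/
noncomputable def tr {A : S.Bd} : S.Lin A A →ₗ[ℂ] ℂ :=
  Finsupp.lsum ℂ fun a => LinearMap.toSpanSingleton ℂ ℂ (P.ζ (S.close a))

theorem tr_single {A : S.Bd} (a : S.Y A A) (r : ℂ) :
    P.tr (Finsupp.single a r) = r * P.ζ (S.close a) := by
  simp [tr]

theorem tr_glueF_comm {A B : S.Bd} (a : S.Lin A B) (b : S.Lin B A) :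
    P.tr (glueF a b) = P.tr (glueF b a) := by
  induction a using Finsupp.induction_linear with
  | zero => simp
  | add f g hf hg => simp only [map_add, LinearMap.add_apply, hf, hg]
  | single a r =>
    induction b using Finsupp.induction_linear with
    | zero => simp
    | add f g hf hg => simp only [map_add, LinearMap.add_apply, hf, hg]
    | single b s => simp only [glueF_single, tr_single, S.close_glue_comm a b, mul_comm]

theorem tr_starF {A : S.Bd} (a : S.Lin A A) : P.tr (starF a) = conj (P.tr a) := by
  induction a using Finsupp.induction_linear with
  | zero => simp
  | add f g hf hg => simp only [map_add, hf, hg]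
  | single a r => simp [starF_single, tr_single, S.close_star, P.reality]

theorem tr_parF {A B : S.Bd} (a : S.Lin A A) (b : S.Lin B B) :
    P.tr (parF a b) = P.tr a * P.tr b := by
  induction a using Finsupp.induction_linear with
  | zero => simp
  | add f g hf hg => simp only [map_add, LinearMap.add_apply, hf, hg, add_mul]
  | single a r =>
    induction b using Finsupp.induction_linear with
    | zero => simp
    | add f g hf hg => simp only [map_add, hf, hg, mul_add]
    | single b s => simp only [parF_single, tr_single, S.close_par, P.factorization]; ring

theorem tr_star_self_nonneg {A B : S.Bd} (a : S.Lin A B) : 0 ≤ (P.tr (glueF (starF a) a)).re := by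
  let e := a.support.equivFin
  obtain ⟨r, hr, h⟩ := P.reflection_positivity _ (fun i => a (e.symm i)) (fun i => (e.symm i : S.Y A B))
  have ha : a = ∑ i, Finsupp.single (e.symm i : S.Y A B) (a (e.symm i)) := by
    conv_lhs => rw [← Finsupp.sum_single a, Finsupp.sum, ← Finset.sum_coe_sort]
    exact (Equiv.sum_comp e.symm (fun x : a.support => Finsupp.single (x : S.Y A B) (a x))).symm
  have : P.tr (glueF (starF a) a) = (r : ℂ) := by
    rw [← h]
    conv_lhs => rw [ha]
    simp only [map_sum, LinearMap.sum_apply, starF_single, glueF_single, tr_single]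
    rw [Finset.sum_comm]
  rw [this]
  simpa using hr

variable (A B : S.Bd)

/-- The pre-inner product space `H_{A ⊔ B}` of formal linear combinations of source manifolds. -/
def PreH (_P : PathIntegral S) (A B : S.Bd) : Type _ := S.Lin A B

noncomputable instance : AddCommGroup (P.PreH A B) := inferInstanceAs (AddCommGroup (S.Y A B →₀ ℂ))

noncomputable instance : Module ℂ (P.PreH A B) := inferInstanceAs (Module ℂ (S.Y A B →₀ ℂ))

/-- The pre-inner product `⟨a|b⟩`: evaluate `ζ` on the closed manifold obtained by sewing `a^*` to
`b` along all of the boundary, which is the closure of `a⋆ b`. -/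
noncomputable abbrev preCore : PreInnerProductSpace.Core ℂ (P.PreH A B) where
  inner a b := P.tr (glueF (starF (show S.Lin A B from a)) (show S.Lin A B from b))
  conj_inner_symm a b := by
    change conj (P.tr (glueF (starF (show S.Lin A B from b)) (show S.Lin A B from a))) = _
    rw [← tr_starF, starF_glueF, starF_starF]
  re_inner_nonneg a := P.tr_star_self_nonneg (show S.Lin A B from a)
  add_left a b c := by
    change P.tr (glueF (starF ((show S.Lin A B from a) + (show S.Lin A B from b))) _) = _
    rw [map_add, map_add, LinearMap.add_apply, map_add]
  smul_left a b r := by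
    change P.tr (glueF (starF (r • (show S.Lin A B from a))) _) = _
    rw [map_smulₛₗ, map_smul, LinearMap.smul_apply, map_smul, smul_eq_mul]

noncomputable instance : SeminormedAddCommGroup (P.PreH A B) :=
  letI := P.preCore A B
  InnerProductSpace.Core.toSeminormedAddCommGroup (𝕜 := ℂ)

noncomputable instance : InnerProductSpace ℂ (P.PreH A B) :=
  InnerProductSpace.ofCore (P.preCore A B)

/-- The Hilbert space `𝓗_{A ⊔ B}`: the completion of `H_{A ⊔ B}`, in which null vectors vanish. -/
abbrev Hilb : Type _ := UniformSpace.Completion (P.PreH A B)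

variable {A B}

/-- The state `|a⟩` defined by a linear combination `a` of source manifolds.  The range of this map
is the dense subspace `𝓓_{A ⊔ B}`, the quotient of `H_{A ⊔ B}` by its null vectors. -/
noncomputable def ket (a : S.Lin A B) : P.Hilb A B := ((show P.PreH A B from a : P.PreH A B) : P.Hilb A B)

theorem inner_ket (a b : S.Lin A B) : inner ℂ (P.ket a) (P.ket b) = P.tr (glueF (starF a) b) :=
  UniformSpace.Completion.inner_coe _ _


theorem norm_sq_eq {A B : S.Bd} (a : S.Lin A B) :
    ‖(show P.PreH A B from a)‖ ^ 2 = (P.tr (glueF (starF a) a)).re :=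
  InnerProductSpace.norm_sq_eq_re_inner (𝕜 := ℂ) (show P.PreH A B from a)

theorem norm_starF {A B : S.Bd} (a : S.Lin A B) :
    ‖(show P.PreH B A from starF a)‖ = ‖(show P.PreH A B from a)‖ := by
  rw [← sq_eq_sq₀ (norm_nonneg _) (norm_nonneg _), norm_sq_eq, norm_sq_eq, starF_starF,
    tr_glueF_comm]

theorem tr_cross {A B C : S.Bd} (a c : S.Lin A B) (b d : S.Lin A C) :
    P.tr (glueF (starF (parF a b)) (swapLF (parF c d))) =
      P.tr (glueF (glueF (starF a) d) (glueF (starF b) c)) := by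
  induction a using Finsupp.induction_linear with
  | zero => simp
  | add f g hf hg => simp only [map_add, LinearMap.add_apply, hf, hg]
  | single a r =>
  induction b using Finsupp.induction_linear with
  | zero => simp
  | add f g hf hg => simp only [map_add, LinearMap.add_apply, hf, hg]
  | single b s =>
  induction c using Finsupp.induction_linear with
  | zero => simp
  | add f g hf hg => simp only [map_add, LinearMap.add_apply, hf, hg]
  | single c t =>
  induction d using Finsupp.induction_linear with
  | zero => simp
  | add f g hf hg => simp only [map_add, LinearMap.add_apply, hf, hg]
  | single d u =>
  simp only [parF_single, starF_single, swapLF_single, glueF_single, tr_single]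
  rw [S.star_par, S.swapL_par, S.glue_swapR, S.par_glue, S.close_swapR_par]
  simp only [map_mul]
  ring

/-- The trace inequality, in the form `⟨ab|ab⟩ ≤ ⟨a|a⟩ ⟨b|b⟩`. -/
theorem norm_glueF_le {A B C : S.Bd} (a : S.Lin A B) (b : S.Lin B C) :
    ‖(show P.PreH A C from glueF a b)‖ ≤
      ‖(show P.PreH A B from a)‖ * ‖(show P.PreH B C from b)‖ := by
  rw [← norm_starF P a]
  refine le_of_sq_le_sq ?_ (by positivity)
  rw [mul_pow, norm_sq_eq, norm_sq_eq, norm_sq_eq]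
  set x := starF a with hx
  have ha : a = starF x := by rw [hx, starF_starF]
  have im0 : ∀ {A B : S.Bd} (z : S.Lin A B), (P.tr (glueF (starF z) z)).im = 0 := by
    intro A B z
    have := P.tr_starF (glueF (starF z) z)
    rw [starF_glueF, starF_starF] at this
    exact Complex.conj_eq_iff_im.mp this.symm
  set s := parF b x with hs
  have h1 : P.tr (glueF (starF s) s) = P.tr (glueF (starF b) b) * P.tr (glueF (starF x) x) := by
    have key : ∀ {A B A' B' : S.Bd} (a b : S.Lin A B) (c d : S.Lin A' B'),
        glueF (starF (parF a c)) (parF b d) = parF (glueF (starF a) b) (glueF (starF c) d) := by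
      intro A B A' B' a b c d
      induction a using Finsupp.induction_linear with
      | zero => simp
      | add f g hf hg => simp only [map_add, LinearMap.add_apply, hf, hg]
      | single a r =>
      induction b using Finsupp.induction_linear with
      | zero => simp
      | add f g hf hg => simp only [map_add, LinearMap.add_apply, hf, hg]
      | single b s =>
      induction c using Finsupp.induction_linear with
      | zero => simp
      | add f g hf hg => simp only [map_add, LinearMap.add_apply, hf, hg]
      | single c t =>
      induction d using Finsupp.induction_linear with
      | zero => simp
      | add f g hf hg => simp only [map_add, hf, hg]
      | single d u =>
      simp only [parF_single, starF_single, glueF_single]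
      rw [S.star_par, S.par_glue]
      congr 1
      simp only [map_mul]
      ring
    rw [hs, key, tr_parF]
  have h2 : P.tr (glueF (starF s) (swapLF s)) = P.tr (glueF (starF (glueF a b)) (glueF a b)) := by
    rw [hs, tr_cross, starF_glueF, ha, starF_starF, glueF_assoc]
  have h3 : P.tr (glueF (starF (swapLF s)) s) = conj (P.tr (glueF (starF s) (swapLF s))) := by
    rw [← tr_starF, starF_glueF, starF_starF]
  have h := P.tr_star_self_nonneg (s - swapLF s)
  simp only [map_sub, LinearMap.sub_apply] at h
  rw [starF_swapLF_glueF, h3, h2, h1] at h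
  simp only [Complex.sub_re, Complex.conj_re, Complex.mul_re, im0] at h
  nlinarith

variable (B : S.Bd)

/-- The operator `â_R = |b⟩ ↦ |ba⟩` of right gluing, on the Hilbert space `𝓗_{B ⊔ B₁}`. -/
noncomputable def glueR {B₁ B₂ : S.Bd} (a : S.Lin B₁ B₂) : P.Hilb B B₁ →L[ℂ] P.Hilb B B₂ :=
  (LinearMap.mkContinuous
    (show P.PreH B B₁ →ₗ[ℂ] P.PreH B B₂ from (glueF (A := B)).flip a)
    ‖(show P.PreH B₁ B₂ from a)‖ fun b => by
      rw [mul_comm]; exact P.norm_glueF_le (A := B) b a).completion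

theorem glueR_ket {B₁ B₂ : S.Bd} (a : S.Lin B₁ B₂) (b : S.Lin B B₁) :
    P.glueR B a (P.ket b) = P.ket (glueF b a) :=
  ContinuousLinearMap.completion_apply_coe _ _

/-- The operator `â_L = |b⟩ ↦ |ab⟩` of left gluing, on the Hilbert space `𝓗_{B₂ ⊔ B}`. -/
noncomputable def glueL {B₁ B₂ : S.Bd} (a : S.Lin B₁ B₂) : P.Hilb B₂ B →L[ℂ] P.Hilb B₁ B :=
  (LinearMap.mkContinuous
    (show P.PreH B₂ B →ₗ[ℂ] P.PreH B₁ B from glueF (C := B) a)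
    ‖(show P.PreH B₁ B₂ from a)‖ fun b => P.norm_glueF_le (C := B) a b).completion

theorem glueL_ket {B₁ B₂ : S.Bd} (a : S.Lin B₁ B₂) (b : S.Lin B₂ B) :
    P.glueL B a (P.ket b) = P.ket (glueF a b) :=
  ContinuousLinearMap.completion_apply_coe _ _

/-- The antilinear continuous extension of `⋆` to the Hilbert space `𝓗_{A ⊔ B}`. -/
noncomputable def starH {A B : S.Bd} : P.Hilb A B →SL[starRingEnd ℂ] P.Hilb B A :=
  (LinearMap.mkContinuous
    (show P.PreH A B →ₛₗ[starRingEnd ℂ] P.PreH B A from starF)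
    1 fun a => by rw [one_mul]; exact (P.norm_starF a).le).completion

theorem starH_ket {A B : S.Bd} (a : S.Lin A B) : P.starH (P.ket a) = P.ket (starF a) :=
  ContinuousLinearMap.completion_apply_coe _ _

/-- The left von Neumann algebra `𝓐_L^{B ⊔ B}`: the closure in the weak operator topology on
`𝓑(𝓗_{B ⊔ B})` of the operators `â_L` given by left gluing of `a ∈ Y_{B ⊔ B}`. -/
def vonNeumannL : Set (P.Hilb B B →L[ℂ] P.Hilb B B) :=
  {d | ContinuousLinearMapWOT.ofCLM d ∈
    closure (Set.range fun a : S.Lin B B => ContinuousLinearMapWOT.ofCLM (P.glueL B a))}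

/-- The right von Neumann algebra `𝓐_R^{B ⊔ B}`. -/
def vonNeumannR : Set (P.Hilb B B →L[ℂ] P.Hilb B B) :=
  {d | ContinuousLinearMapWOT.ofCLM d ∈
    closure (Set.range fun a : S.Lin B B => ContinuousLinearMapWOT.ofCLM (P.glueR B a))}

/-- The cylinder of length `ε`, as a linear combination of source manifolds. -/
noncomputable def cylF (ε : {ε : ℝ // 0 < ε}) : S.Lin B B := Finsupp.single (S.cyl B ε) 1

/-- `T = Φ^L_{B B'}(d)` on the dense subspace: if `ψ = C_ε χ` has a left rim that contains the
cylinder `C_ε`, then `T |ψ⟩ = χ̂_R d |C_ε⟩`. -/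
def IsPhiL (B B' : S.Bd) (d : P.Hilb B B →L[ℂ] P.Hilb B B)
    (T : P.Hilb B B' →L[ℂ] P.Hilb B B') : Prop :=
  ∀ (ε : {ε : ℝ // 0 < ε}) (χ : S.Lin B B'),
    T (P.ket (glueF (cylF B ε) χ)) = P.glueR B χ (d (P.ket (cylF B ε)))

/-- `T = Φ^R_{B B'}(d)` on the dense subspace: if `ψ = χ C_ε` has a right rim that contains the
cylinder `C_ε`, then `T |ψ⟩ = χ̂_L d |C_ε⟩`. -/
def IsPhiR (B B' : S.Bd) (d : P.Hilb B' B' →L[ℂ] P.Hilb B' B')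
    (T : P.Hilb B B' →L[ℂ] P.Hilb B B') : Prop :=
  ∀ (ε : {ε : ℝ // 0 < ε}) (χ : S.Lin B B'),
    T (P.ket (glueF χ (cylF B' ε))) = P.glueL B' χ (d (P.ket (cylF B' ε)))

open Classical in
/-- The homomorphism `Φ^L_{B B'}` from `𝓐_L^{B ⊔ B}` to the bounded operators on `𝓗_{B ⊔ B'}`
(with the value `0` on operators outside its domain for which no such operator exists). -/
noncomputable def PhiL (B B' : S.Bd) (d : P.Hilb B B →L[ℂ] P.Hilb B B) :
    P.Hilb B B' →L[ℂ] P.Hilb B B' :=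
  if h : ∃ T, P.IsPhiL B B' d T then h.choose else 0

open Classical in
/-- The homomorphism `Φ^R_{B B'}` from `𝓐_R^{B' ⊔ B'}` to the bounded operators on `𝓗_{B ⊔ B'}`
(with the value `0` on operators outside its domain for which no such operator exists). -/
noncomputable def PhiR (B B' : S.Bd) (d : P.Hilb B' B' →L[ℂ] P.Hilb B' B') :
    P.Hilb B B' →L[ℂ] P.Hilb B B' :=
  if h : ∃ T, P.IsPhiR B B' d T then h.choose else 0

/-- A map `Ψ : 𝓗_{B₁ ⊔ B₂} → 𝓑(𝓗_{B ⊔ B₁}, 𝓗_{B ⊔ B₂})` that is continuous from the norm topology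
to the strong operator topology and extends right gluing. -/
def IsRightGluing (B B₁ B₂ : S.Bd)
    (Ψ : P.Hilb B₁ B₂ → (P.Hilb B B₁ →L[ℂ] P.Hilb B B₂)) : Prop :=
  (Continuous fun x => ContinuousLinearMap.toPointwiseConvergenceCLM ℂ (RingHom.id ℂ)
    (P.Hilb B B₁) (P.Hilb B B₂) (Ψ x)) ∧
  ∀ (a : S.Lin B₁ B₂) (b : S.Lin B B₁), Ψ (P.ket a) (P.ket b) = P.ket (glueF b a)

/-- A map `Ψ : 𝓗_{B₁ ⊔ B₂} → 𝓑(𝓗_{B₂ ⊔ B}, 𝓗_{B₁ ⊔ B})` that is continuous from the norm topology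
to the strong operator topology and extends left gluing. -/
def IsLeftGluing (B₁ B₂ B : S.Bd)
    (Ψ : P.Hilb B₁ B₂ → (P.Hilb B₂ B →L[ℂ] P.Hilb B₁ B)) : Prop :=
  (Continuous fun x => ContinuousLinearMap.toPointwiseConvergenceCLM ℂ (RingHom.id ℂ)
    (P.Hilb B₂ B) (P.Hilb B₁ B) (Ψ x)) ∧
  ∀ (a : S.Lin B₁ B₂) (b : S.Lin B₂ B), Ψ (P.ket a) (P.ket b) = P.ket (glueF a b)

end PathIntegral

/-! Gluing is jointly bounded: the trace inequality `norm_glueF_le` makes `a ↦ â_R` and `a ↦ â_L`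
linear contractions into bounded operators, so both extend by density to the Hilbert space,
continuously even for the operator norm. Uniqueness, the adjoint relations and the intertwining
relations are then checked on states and carried over by density.

The real content is that `Φ^L(d)` exists and is bounded, that is, `‖χ̂_R d |C_ε⟩‖ ≤ ‖d‖ ‖C_ε χ‖`.
Put `X = χ̂_R`, so that `|C_ε χ⟩ = X |C_ε⟩`. Then `X† X` is right gluing of `χ χ⋆`, an element of
`H_{B ⊔ B}`, and it commutes with `d`, since commuting with right gluing passes to weak operator
limits of left gluings. Hence `d` commutes with `|X|`, and `‖X d v‖ = ‖d |X| v‖ ≤ ‖d‖ ‖X v‖`. This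
is `norm_apply_le_of_commute_adjoint_comp_self`. Rims supply enough vectors `C_ε χ`, and `C_ε C_δ =
C_{ε+δ}` makes the prescriptions for different lengths agree (`exists_clm_of_rim`). The side `Φ^R`
is the mirror image, with `χ⋆ χ` in place of `χ χ⋆`. -/

/-- If `T` commutes with `X† X`, it commutes with `|X|`, and so it is bounded by `‖T‖` for the
seminorm `v ↦ ‖X v‖`. -/
theorem ContinuousLinearMap.norm_apply_le_of_commute_adjoint_comp_self {H K : Type*}
    [NormedAddCommGroup H] [InnerProductSpace ℂ H] [CompleteSpace H]
    [NormedAddCommGroup K] [InnerProductSpace ℂ K] [CompleteSpace K]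
    (X : H →L[ℂ] K) (T : H →L[ℂ] H) (h : Commute (adjoint X ∘L X) T) (v : H) :
    ‖X (T v)‖ ≤ ‖T‖ * ‖X v‖ := by
  set p : H →L[ℂ] H := adjoint X ∘L X with hp
  have hp0 : 0 ≤ p := by
    rw [ContinuousLinearMap.nonneg_iff_isPositive]
    exact ContinuousLinearMap.isPositive_adjoint_comp_self X
  set s := CFC.sqrt p with hs
  have hss : s * s = p := CFC.sqrt_mul_sqrt_self p hp0
  have hsa : adjoint s = s := (CFC.sqrt_nonneg p).isSelfAdjoint
  -- `T` need not be normal: the square root comes from the functional calculus of the positive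
  -- operator `p`, which stays in the commutant of whatever commutes with `p`.
  have hcomm : Commute s T := h.cfcₙ_nnreal _
  have key : ∀ w, ‖X w‖ = ‖s w‖ := fun w => by
    rw [← sq_eq_sq₀ (norm_nonneg _) (norm_nonneg _),
      ContinuousLinearMap.apply_norm_sq_eq_inner_adjoint_left (𝕜 := ℂ) X,
      ContinuousLinearMap.apply_norm_sq_eq_inner_adjoint_left (𝕜 := ℂ) s, hsa]
    change _ = RCLike.re (inner ℂ ((s * s) w) w)
    rw [hss]
  rw [key, key]
  have : s (T v) = T (s v) := congrArg (fun f : H →L[ℂ] H => f v) hcomm.eq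
  rw [this]
  exact T.le_opNorm _

namespace PathIntegral
open SourceManifolds
variable {S : SourceManifolds} (P : PathIntegral S)

/-! ### States, and extension of maps from the dense subspace. -/

/-- The map `a ↦ |a⟩` as a linear map. -/
noncomputable def ketₗ (A B : S.Bd) : S.Lin A B →ₗ[ℂ] P.Hilb A B :=
  (UniformSpace.Completion.toComplₗᵢ (𝕜 := ℂ) (E := P.PreH A B)).toLinearMap

theorem ketₗ_apply {A B : S.Bd} (a : S.Lin A B) : P.ketₗ A B a = P.ket a := rfl

theorem ket_add {A B : S.Bd} (a b : S.Lin A B) : P.ket (a + b) = P.ket a + P.ket b :=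
  map_add (P.ketₗ A B) a b

theorem ket_smul {A B : S.Bd} (t : ℂ) (a : S.Lin A B) : P.ket (t • a) = t • P.ket a :=
  map_smul (P.ketₗ A B) t a

theorem denseRange_ket (A B : S.Bd) : DenseRange (P.ket (A := A) (B := B)) :=
  UniformSpace.Completion.denseRange_coe (α := P.PreH A B)

theorem denseRange_ketₗ (A B : S.Bd) : DenseRange (P.ketₗ A B) := P.denseRange_ket A B

theorem norm_ket_glueF_le {A B C : S.Bd} (a : S.Lin A B) (b : S.Lin B C) :
    ‖P.ket (glueF a b)‖ ≤ ‖P.ket a‖ * ‖P.ket b‖ := by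
  have h : ∀ {A B : S.Bd} (c : S.Lin A B), ‖P.ket c‖ = ‖(show P.PreH A B from c)‖ :=
    fun c => UniformSpace.Completion.norm_coe _
  rw [h, h, h]
  exact P.norm_glueF_le a b

theorem clm_ext {A B : S.Bd} {E : Type*} [NormedAddCommGroup E] [NormedSpace ℂ E]
    {T T' : P.Hilb A B →L[ℂ] E} (h : ∀ a, T (P.ket a) = T' (P.ket a)) : T = T' :=
  ContinuousLinearMap.ext fun x =>
    congrFun ((P.denseRange_ket A B).equalizer T.continuous T'.continuous (funext h)) x

/-- A bounded linear map from the states is extended to the Hilbert space. -/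
theorem exists_clm_ket {A B : S.Bd} {E : Type*} [NormedAddCommGroup E] [NormedSpace ℂ E]
    [CompleteSpace E] (f : S.Lin A B →ₗ[ℂ] E) (K : ℝ) (hf : ∀ a, ‖f a‖ ≤ K * ‖P.ket a‖) :
    ∃ T : P.Hilb A B →L[ℂ] E, ∀ a, T (P.ket a) = f a :=
  ⟨f.extendOfNorm (P.ketₗ A B), fun a =>
    LinearMap.extendOfNorm_eq (P.denseRange_ketₗ A B) ⟨K, hf⟩ a⟩

/-- The bounded operators into a complete space are themselves complete, so operator-valued maps
extend too. This is the form used for gluing. -/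
theorem exists_clm_clm_ket {A B : S.Bd} {E F : Type*} [NormedAddCommGroup E] [NormedSpace ℂ E]
    [NormedAddCommGroup F] [NormedSpace ℂ F] [CompleteSpace F] (f : S.Lin A B →ₗ[ℂ] E →L[ℂ] F)
    (K : ℝ) (hf : ∀ a, ‖f a‖ ≤ K * ‖P.ket a‖) :
    ∃ T : P.Hilb A B →L[ℂ] E →L[ℂ] F, ∀ a, T (P.ket a) = f a :=
  P.exists_clm_ket f K hf

/-- Bounded linear maps `g ε` on the subspaces of states with a rim of length `ε` that are
compatible with the inclusions of these subspaces have a common extension. -/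
theorem exists_clm_of_rim {A B : S.Bd} {E : Type*} [NormedAddCommGroup E] [NormedSpace ℂ E]
    [CompleteSpace E] (r : {ε : ℝ // 0 < ε} → S.Lin A B →ₗ[ℂ] S.Lin A B)
    (g : {ε : ℝ // 0 < ε} → S.Lin A B →ₗ[ℂ] E) (K : ℝ)
    (hg : ∀ ε χ, ‖g ε χ‖ ≤ K * ‖P.ket (r ε χ)‖)
    (hshift : ∀ ε δ : {ε : ℝ // 0 < ε}, ε < δ → ∀ χ, ∃ χ', r δ χ = r ε χ' ∧ g δ χ = g ε χ')
    (hrim : ∀ y : S.Y A B, ∃ ε χ, Finsupp.single y 1 = r ε χ) :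
    ∃ T : P.Hilb A B →L[ℂ] E, ∀ ε χ, T (P.ket (r ε χ)) = g ε χ := by
  -- `hshift` is assumed only for `ε < δ` because `δ - ε` has to be the length of a cylinder;
  -- equality is trivial.
  have hshift' : ∀ ε δ : {ε : ℝ // 0 < ε}, ε ≤ δ → ∀ χ, ∃ χ', r δ χ = r ε χ' ∧ g δ χ = g ε χ' := by
    intro ε δ h χ
    rcases h.eq_or_lt with rfl | h
    · exact ⟨χ, rfl, rfl⟩
    · exact hshift ε δ h χ
  -- A linear combination is finite, so its terms share the shortest of their rims.
  have hrim' : ∀ a, ∃ ε χ, a = r ε χ := by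
    intro a
    induction a using Finsupp.induction_linear with
    | zero => exact ⟨⟨1, one_pos⟩, 0, (map_zero _).symm⟩
    | add a b ha hb =>
      obtain ⟨ε, χ, rfl⟩ := ha
      obtain ⟨δ, ξ, rfl⟩ := hb
      obtain ⟨χ', h, -⟩ := hshift' (min ε δ) ε (min_le_left _ _) χ
      obtain ⟨ξ', h', -⟩ := hshift' (min ε δ) δ (min_le_right _ _) ξ
      exact ⟨min ε δ, χ' + ξ', by rw [h, h', map_add]⟩
    | single y c =>
      obtain ⟨ε, χ, h⟩ := hrim y
      exact ⟨ε, c • χ, by rw [map_smul, ← h, Finsupp.smul_single, smul_eq_mul, mul_one]⟩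
  -- No injectivity of `r` is needed: at the common length `min ε δ`, the bound `hg` makes `g`
  -- vanish wherever `r` does.
  have hwd : ∀ ε δ χ ξ, r ε χ = r δ ξ → g ε χ = g δ ξ := by
    intro ε δ χ ξ h
    obtain ⟨χ', h1, h2⟩ := hshift' (min ε δ) ε (min_le_left _ _) χ
    obtain ⟨ξ', h3, h4⟩ := hshift' (min ε δ) δ (min_le_right _ _) ξ
    rw [h2, h4, ← sub_eq_zero, ← map_sub, ← norm_le_zero_iff]
    refine (hg _ _).trans (le_of_eq ?_)
    rw [map_sub, ← h1, ← h3, h, sub_self, ← ketₗ_apply, map_zero, norm_zero, mul_zero]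
  -- The choice of a rim for each `a` is arbitrary and not linear; `hwd` is what makes `F` linear.
  choose e c hc using hrim'
  have hF : ∀ ε χ, g (e (r ε χ)) (c (r ε χ)) = g ε χ := fun ε χ => hwd _ _ _ _ (hc _).symm
  let F : S.Lin A B →ₗ[ℂ] E :=
    { toFun := fun a => g (e a) (c a)
      map_add' := by
        intro a b
        obtain ⟨χ', h1, h2⟩ := hshift' (min (e a) (e b)) (e a) (min_le_left _ _) (c a)
        obtain ⟨ξ', h3, h4⟩ := hshift' (min (e a) (e b)) (e b) (min_le_right _ _) (c b)
        rw [h2, h4, ← map_add]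
        refine hwd _ _ _ _ ?_
        rw [← hc, map_add, ← h1, ← h3, ← hc, ← hc]
      map_smul' := by
        intro t a
        rw [RingHom.id_apply, ← map_smul]
        refine hwd _ _ _ _ ?_
        rw [← hc, map_smul, ← hc] }
  obtain ⟨T, hT⟩ := P.exists_clm_ket F K fun a => by
    conv_rhs => rw [hc a]
    exact hg _ _
  exact ⟨T, fun ε χ => (hT _).trans (hF ε χ)⟩

/-! ### Algebra and norm bounds of the gluing operators. -/

variable (B : S.Bd)

/-- Cyclicity of the trace: `tr((c a⋆)⋆ b) = tr(a c⋆ b) = tr(c⋆ b a)`. -/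
theorem adjoint_glueR {B₁ B₂ : S.Bd} (a : S.Lin B₁ B₂) :
    ContinuousLinearMap.adjoint (P.glueR B a) = P.glueR B (starF a) := by
  symm
  refine (ContinuousLinearMap.eq_adjoint_iff _ _).2 fun x y => ?_
  refine (P.denseRange_ket B B₂).induction_on x (isClosed_eq (by fun_prop) (by fun_prop)) fun c => ?_
  refine (P.denseRange_ket B B₁).induction_on y (isClosed_eq (by fun_prop) (by fun_prop)) fun b => ?_
  rw [glueR_ket, glueR_ket, inner_ket, inner_ket, starF_glueF, starF_starF, glueF_assoc,
    tr_glueF_comm, glueF_assoc]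

/-- Here associativity alone suffices: `(a⋆ c)⋆ b = c⋆ (a b)`. -/
theorem adjoint_glueL {B₁ B₂ : S.Bd} (a : S.Lin B₁ B₂) :
    ContinuousLinearMap.adjoint (P.glueL B a) = P.glueL B (starF a) := by
  symm
  refine (ContinuousLinearMap.eq_adjoint_iff _ _).2 fun x y => ?_
  refine (P.denseRange_ket B₁ B).induction_on x (isClosed_eq (by fun_prop) (by fun_prop)) fun c => ?_
  refine (P.denseRange_ket B₂ B).induction_on y (isClosed_eq (by fun_prop) (by fun_prop)) fun b => ?_
  rw [glueL_ket, glueL_ket, inner_ket, inner_ket, starF_glueF, starF_starF, glueF_assoc]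

theorem glueR_comp_glueR {B₁ B₂ B₃ : S.Bd} (a : S.Lin B₁ B₂) (b : S.Lin B₂ B₃) :
    P.glueR B b ∘L P.glueR B a = P.glueR B (glueF a b) :=
  P.clm_ext fun c => by simp only [ContinuousLinearMap.comp_apply, glueR_ket, glueF_assoc]

theorem glueL_comp_glueL {B₁ B₂ B₃ : S.Bd} (a : S.Lin B₁ B₂) (b : S.Lin B₂ B₃) :
    P.glueL B a ∘L P.glueL B b = P.glueL B (glueF a b) :=
  P.clm_ext fun c => by simp only [ContinuousLinearMap.comp_apply, glueL_ket, glueF_assoc]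

theorem commute_glueL_glueR (a b : S.Lin B B) : Commute (P.glueL B a) (P.glueR B b) :=
  P.clm_ext fun c => by
    simp only [mul_apply_eq_comp, glueL_ket, glueR_ket, glueF_assoc]

/-- The right gluing operators, as a linear map. -/
noncomputable def glueRₗ (B₁ B₂ : S.Bd) :
    S.Lin B₁ B₂ →ₗ[ℂ] P.Hilb B B₁ →L[ℂ] P.Hilb B B₂ where
  toFun := P.glueR B
  map_add' a b := P.clm_ext fun c => by
    simp only [add_apply, glueR_ket, map_add, ket_add]
  map_smul' t a := P.clm_ext fun c => by
    simp only [smul_apply, glueR_ket, map_smul, ket_smul, RingHom.id_apply]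

/-- The left gluing operators, as a linear map. -/
noncomputable def glueLₗ (B₁ B₂ : S.Bd) :
    S.Lin B₁ B₂ →ₗ[ℂ] P.Hilb B₂ B →L[ℂ] P.Hilb B₁ B where
  toFun := P.glueL B
  map_add' a b := P.clm_ext fun c => by
    simp only [add_apply, glueL_ket, map_add, LinearMap.add_apply, ket_add]
  map_smul' t a := P.clm_ext fun c => by
    simp only [smul_apply, glueL_ket, map_smul, LinearMap.smul_apply, ket_smul, RingHom.id_apply]

/-- The trace inequality on states, extended by density. The factor `1` is the constant `K` of the
extension lemma. -/
theorem norm_glueRₗ_le {B₁ B₂ : S.Bd} (a : S.Lin B₁ B₂) :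
    ‖P.glueRₗ B B₁ B₂ a‖ ≤ 1 * ‖P.ket a‖ := by
  rw [one_mul]
  refine ContinuousLinearMap.opNorm_le_bound _ (norm_nonneg _) fun x => ?_
  refine (P.denseRange_ket B B₁).induction_on x (isClosed_le (by fun_prop) (by fun_prop)) fun b => ?_
  change ‖P.glueR B a (P.ket b)‖ ≤ _
  rw [glueR_ket, mul_comm]
  exact P.norm_ket_glueF_le b a

theorem norm_glueLₗ_le {B₁ B₂ : S.Bd} (a : S.Lin B₁ B₂) :
    ‖P.glueLₗ B B₁ B₂ a‖ ≤ 1 * ‖P.ket a‖ := by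
  rw [one_mul]
  refine ContinuousLinearMap.opNorm_le_bound _ (norm_nonneg _) fun x => ?_
  refine (P.denseRange_ket B₂ B).induction_on x (isClosed_le (by fun_prop) (by fun_prop)) fun b => ?_
  change ‖P.glueL B a (P.ket b)‖ ≤ _
  rw [glueL_ket]
  exact P.norm_ket_glueF_le a b

/-! ### Gluing by vectors of the Hilbert space. -/

theorem exists_psiR (B₁ B₂ : S.Bd) :
    ∃ Ψ : P.Hilb B₁ B₂ →L[ℂ] P.Hilb B B₁ →L[ℂ] P.Hilb B B₂, ∀ a, Ψ (P.ket a) = P.glueR B a :=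
  P.exists_clm_clm_ket (P.glueRₗ B B₁ B₂) 1
    (P.norm_glueRₗ_le B)

/-- Right gluing of a vector of the Hilbert space `𝓗_{B₁ ⊔ B₂}`. -/
noncomputable def psiR (B₁ B₂ : S.Bd) :
    P.Hilb B₁ B₂ →L[ℂ] P.Hilb B B₁ →L[ℂ] P.Hilb B B₂ :=
  (P.exists_psiR B B₁ B₂).choose

theorem psiR_ket {B₁ B₂ : S.Bd} (a : S.Lin B₁ B₂) : P.psiR B B₁ B₂ (P.ket a) = P.glueR B a :=
  (P.exists_psiR B B₁ B₂).choose_spec a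

theorem exists_psiL (B₁ B₂ : S.Bd) :
    ∃ Ψ : P.Hilb B₁ B₂ →L[ℂ] P.Hilb B₂ B →L[ℂ] P.Hilb B₁ B, ∀ a, Ψ (P.ket a) = P.glueL B a :=
  P.exists_clm_clm_ket (P.glueLₗ B B₁ B₂) 1
    (P.norm_glueLₗ_le B)

/-- Left gluing of a vector of the Hilbert space `𝓗_{B₁ ⊔ B₂}`. -/
noncomputable def psiL (B₁ B₂ : S.Bd) :
    P.Hilb B₁ B₂ →L[ℂ] P.Hilb B₂ B →L[ℂ] P.Hilb B₁ B :=
  (P.exists_psiL B B₁ B₂).choose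

theorem psiL_ket {B₁ B₂ : S.Bd} (a : S.Lin B₁ B₂) : P.psiL B B₁ B₂ (P.ket a) = P.glueL B a :=
  (P.exists_psiL B B₁ B₂).choose_spec a

/-- Continuity into the operator norm is stronger than continuity into the strong operator topology.
-/
theorem isRightGluing_psiR (B₁ B₂ : S.Bd) : P.IsRightGluing B B₁ B₂ (P.psiR B B₁ B₂) :=
  ⟨(ContinuousLinearMap.continuous _).comp (ContinuousLinearMap.continuous _),
    fun a b => by rw [psiR_ket, glueR_ket]⟩

theorem isLeftGluing_psiL (B₁ B₂ : S.Bd) : P.IsLeftGluing B₁ B₂ B (P.psiL B B₁ B₂) :=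
  ⟨(ContinuousLinearMap.continuous _).comp (ContinuousLinearMap.continuous _),
    fun a b => by rw [psiL_ket, glueL_ket]⟩

/-- A pointwise continuous map into the bounded operators is determined by its values on states. -/
theorem eq_of_pointwise_continuous {B₁ B₂ A C A' C' : S.Bd}
    {Ψ Ψ' : P.Hilb B₁ B₂ → (P.Hilb A C →L[ℂ] P.Hilb A' C')}
    (h : Continuous fun x => ContinuousLinearMap.toPointwiseConvergenceCLM ℂ (RingHom.id ℂ)
      (P.Hilb A C) (P.Hilb A' C') (Ψ x))
    (h' : Continuous fun x => ContinuousLinearMap.toPointwiseConvergenceCLM ℂ (RingHom.id ℂ)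
      (P.Hilb A C) (P.Hilb A' C') (Ψ' x))
    (hk : ∀ a b, Ψ (P.ket a) (P.ket b) = Ψ' (P.ket a) (P.ket b)) : Ψ = Ψ' := by
  refine funext fun x => ContinuousLinearMap.ext fun v => ?_
  refine congrFun ((P.denseRange_ket B₁ B₂).equalizer ((continuous_eval_const v).comp h)
    ((continuous_eval_const v).comp h') (funext fun a => ?_)) x
  exact DFunLike.congr_fun (P.clm_ext (hk a)) v

/-! ### Commutants and the construction of `Φ^L` and `Φ^R`. -/

/-- Left and right gluing commute by associativity, and commuting with a fixed bounded operator is a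
closed condition in the weak operator topology. -/
theorem commute_glueR_of_mem_vonNeumannL {d : P.Hilb B B →L[ℂ] P.Hilb B B}
    (hd : d ∈ P.vonNeumannL B) (b : S.Lin B B) : Commute d (P.glueR B b) := by
  suffices h : ∀ x, d (P.glueR B b x) = P.glueR B b (d x) from ContinuousLinearMap.ext h
  intro x
  refine ext_inner_left ℂ fun v => ?_
  -- With the gluing operator moved to the bra, both sides are matrix elements of `d`, hence weakly
  -- continuous in it.
  rw [← ContinuousLinearMap.adjoint_inner_left (P.glueR B b)]
  have hc : ∀ u w : P.Hilb B B, Continuous fun T : ContinuousLinearMapWOT (RingHom.id ℂ)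
      (P.Hilb B B) (P.Hilb B B) => inner ℂ u (T w) := fun u w =>
    ContinuousLinearMapWOT.continuous_dual_apply w (innerSL ℂ u)
  refine closure_minimal (t := {T | inner ℂ v (T (P.glueR B b x)) =
    inner ℂ (ContinuousLinearMap.adjoint (P.glueR B b) v) (T x)}) ?_
    (isClosed_eq (hc _ _) (hc _ _)) hd
  rintro _ ⟨a, rfl⟩
  change inner ℂ v (P.glueL B a (P.glueR B b x)) = inner ℂ _ (P.glueL B a x)
  rw [ContinuousLinearMap.adjoint_inner_left]
  exact congrArg (inner ℂ v) (DFunLike.congr_fun (P.commute_glueL_glueR B a b) x)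

theorem commute_glueL_of_mem_vonNeumannR {d : P.Hilb B B →L[ℂ] P.Hilb B B}
    (hd : d ∈ P.vonNeumannR B) (b : S.Lin B B) : Commute d (P.glueL B b) := by
  suffices h : ∀ x, d (P.glueL B b x) = P.glueL B b (d x) from ContinuousLinearMap.ext h
  intro x
  refine ext_inner_left ℂ fun v => ?_
  rw [← ContinuousLinearMap.adjoint_inner_left (P.glueL B b)]
  have hc : ∀ u w : P.Hilb B B, Continuous fun T : ContinuousLinearMapWOT (RingHom.id ℂ)
      (P.Hilb B B) (P.Hilb B B) => inner ℂ u (T w) := fun u w =>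
    ContinuousLinearMapWOT.continuous_dual_apply w (innerSL ℂ u)
  refine closure_minimal (t := {T | inner ℂ v (T (P.glueL B b x)) =
    inner ℂ (ContinuousLinearMap.adjoint (P.glueL B b) v) (T x)}) ?_
    (isClosed_eq (hc _ _) (hc _ _)) hd
  rintro _ ⟨a, rfl⟩
  change inner ℂ v (P.glueR B a (P.glueL B b x)) = inner ℂ _ (P.glueR B a x)
  rw [ContinuousLinearMap.adjoint_inner_left]
  exact congrArg (inner ℂ v) (DFunLike.congr_fun (P.commute_glueL_glueR B b a).symm x)

theorem glueF_cylF_cylF_sub {ε δ : {ε : ℝ // 0 < ε}} (h : ε < δ) :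
    glueF (cylF B ε) (cylF B ⟨δ.1 - ε.1, sub_pos.2 h⟩) = (cylF B δ : S.Lin B B) := by
  rw [cylF, cylF, glueF_single, S.glue_cyl_cyl, cylF, mul_one]
  congr 3
  exact add_sub_cancel _ _

theorem glueF_cylF_sub_cylF {ε δ : {ε : ℝ // 0 < ε}} (h : ε < δ) :
    glueF (cylF B ⟨δ.1 - ε.1, sub_pos.2 h⟩) (cylF B ε) = (cylF B δ : S.Lin B B) := by
  rw [cylF, cylF, glueF_single, S.glue_cyl_cyl, cylF, mul_one]
  congr 3
  exact sub_add_cancel _ _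

theorem exists_isPhiL (B' : S.Bd) {d : P.Hilb B B →L[ℂ] P.Hilb B B} (hd : d ∈ P.vonNeumannL B) :
    ∃ T, P.IsPhiL B B' d T := by
  have hcomm := P.commute_glueR_of_mem_vonNeumannL B hd
  refine P.exists_clm_of_rim (fun ε => glueF (cylF B ε))
    (fun ε => (ContinuousLinearMap.apply ℂ _ (d (P.ket (cylF B ε)))).toLinearMap ∘ₗ P.glueRₗ B B B') ‖d‖ (fun ε χ => ?_)
    (fun ε δ h χ => ⟨glueF (cylF B ⟨δ.1 - ε.1, sub_pos.2 h⟩) χ, ?_, ?_⟩) fun y => ?_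
  · change ‖P.glueR B χ (d (P.ket (cylF B ε)))‖ ≤ _
    rw [← glueR_ket]
    -- The commutation required is with right gluing of `χ χ⋆`, which acts on `𝓗_{B ⊔ B}` whatever
    -- `B'` is.
    refine (P.glueR B χ).norm_apply_le_of_commute_adjoint_comp_self d ?_ _
    rw [adjoint_glueR, glueR_comp_glueR]
    exact (hcomm _).symm
  · rw [← glueF_assoc, glueF_cylF_cylF_sub B h]
  · change P.glueR B χ (d (P.ket (cylF B δ))) = P.glueR B _ (d (P.ket (cylF B ε)))
    -- Write `C_δ = C_ε C_{δ-ε}` and pull right gluing of `C_{δ-ε}` out through `d`.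
    rw [← glueR_comp_glueR, ← glueF_cylF_cylF_sub B h, ← glueR_ket]
    exact congrArg (P.glueR B χ) (DFunLike.congr_fun (hcomm _) _)
  · obtain ⟨ε, y', h⟩ := S.rimL y
    exact ⟨ε, Finsupp.single y' 1, by rw [cylF, glueF_single, mul_one, ← h]⟩

theorem exists_isPhiR (B' : S.Bd) {d : P.Hilb B' B' →L[ℂ] P.Hilb B' B'}
    (hd : d ∈ P.vonNeumannR B') : ∃ T, P.IsPhiR B B' d T := by
  have hcomm := P.commute_glueL_of_mem_vonNeumannR B' hd
  refine P.exists_clm_of_rim (fun ε => glueF.flip (cylF B' ε))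
    (fun ε => (ContinuousLinearMap.apply ℂ _ (d (P.ket (cylF B' ε)))).toLinearMap ∘ₗ P.glueLₗ B' B B') ‖d‖ (fun ε χ => ?_)
    (fun ε δ h χ => ⟨glueF χ (cylF B' ⟨δ.1 - ε.1, sub_pos.2 h⟩), ?_, ?_⟩) fun y => ?_
  · change ‖P.glueL B' χ (d (P.ket (cylF B' ε)))‖ ≤ _ * ‖P.ket (glueF χ (cylF B' ε))‖
    rw [← glueL_ket]
    refine (P.glueL B' χ).norm_apply_le_of_commute_adjoint_comp_self d ?_ _
    rw [adjoint_glueL, glueL_comp_glueL]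
    exact (hcomm _).symm
  · rw [LinearMap.flip_apply, LinearMap.flip_apply, glueF_assoc, glueF_cylF_sub_cylF B' h]
  · change P.glueL B' χ (d (P.ket (cylF B' δ))) = P.glueL B' _ (d (P.ket (cylF B' ε)))
    rw [← glueL_comp_glueL, ← glueF_cylF_sub_cylF B' h, ← glueL_ket]
    exact congrArg (P.glueL B' χ) (DFunLike.congr_fun (hcomm _) _)
  · obtain ⟨ε, y', h⟩ := S.rimR y
    exact ⟨ε, Finsupp.single y' 1, by
      rw [LinearMap.flip_apply, cylF, glueF_single, mul_one, ← h]⟩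

theorem isPhiL_PhiL (B' : S.Bd) {d : P.Hilb B B →L[ℂ] P.Hilb B B} (hd : d ∈ P.vonNeumannL B) :
    P.IsPhiL B B' d (P.PhiL B B' d) := by
  rw [PhiL, dif_pos (P.exists_isPhiL B B' hd)]
  exact (P.exists_isPhiL B B' hd).choose_spec

theorem isPhiR_PhiR (B' : S.Bd) {d : P.Hilb B' B' →L[ℂ] P.Hilb B' B'}
    (hd : d ∈ P.vonNeumannR B') : P.IsPhiR B B' d (P.PhiR B B' d) := by
  rw [PhiR, dif_pos (P.exists_isPhiR B B' hd)]
  exact (P.exists_isPhiR B B' hd).choose_spec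

/-! ### Density of the rimmed states, and the intertwining relations. -/

variable {B}

/-- Bounded operators that agree on the states `|C_ε χ⟩` are equal. -/
theorem clm_ext_cylF_left {B' : S.Bd} {E : Type*} [NormedAddCommGroup E] [NormedSpace ℂ E]
    {T T' : P.Hilb B B' →L[ℂ] E}
    (h : ∀ ε χ, T (P.ket (glueF (cylF B ε) χ)) = T' (P.ket (glueF (cylF B ε) χ))) : T = T' := by
  refine P.clm_ext fun a => ?_
  suffices T.toLinearMap ∘ₗ P.ketₗ B B' = T'.toLinearMap ∘ₗ P.ketₗ B B' from
    LinearMap.congr_fun this a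
  -- By linearity a single manifold can be tested at a time, and each one has its own rim.
  refine Finsupp.lhom_ext' fun y => LinearMap.ext_ring ?_
  obtain ⟨ε, y', hy⟩ := S.rimL y
  have := h ε (Finsupp.single y' 1)
  rwa [cylF, glueF_single, mul_one, ← hy] at this

/-- Bounded operators that agree on the states `|χ C_ε⟩` are equal. -/
theorem clm_ext_cylF_right {B' : S.Bd} {E : Type*} [NormedAddCommGroup E] [NormedSpace ℂ E]
    {T T' : P.Hilb B B' →L[ℂ] E}
    (h : ∀ ε χ, T (P.ket (glueF χ (cylF B' ε))) = T' (P.ket (glueF χ (cylF B' ε)))) : T = T' := by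
  refine P.clm_ext fun a => ?_
  suffices T.toLinearMap ∘ₗ P.ketₗ B B' = T'.toLinearMap ∘ₗ P.ketₗ B B' from
    LinearMap.congr_fun this a
  refine Finsupp.lhom_ext' fun y => LinearMap.ext_ring ?_
  obtain ⟨ε, y', hy⟩ := S.rimR y
  have := h ε (Finsupp.single y' 1)
  rwa [cylF, glueF_single, mul_one, ← hy] at this

/-- On `|C_ε χ⟩` and for a state `a`, both sides are right gluing of `χ a` applied to `d |C_ε⟩`.
Both sides are norm continuous in `a`. -/
theorem PhiL_comp_psiR {B₁ B₂ : S.Bd} (a : P.Hilb B₁ B₂) {d : P.Hilb B B →L[ℂ] P.Hilb B B}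
    (hd : d ∈ P.vonNeumannL B) :
    P.PhiL B B₂ d ∘L P.psiR B B₁ B₂ a = P.psiR B B₁ B₂ a ∘L P.PhiL B B₁ d := by
  refine (P.denseRange_ket B₁ B₂).induction_on a (isClosed_eq (by fun_prop) (by fun_prop))
    fun a => P.clm_ext_cylF_left fun ε χ => ?_
  simp only [ContinuousLinearMap.comp_apply, psiR_ket, glueR_ket, glueF_assoc,
    P.isPhiL_PhiL B _ hd ε]
  rw [← glueR_comp_glueR, ContinuousLinearMap.comp_apply]

theorem PhiR_comp_psiL {B₁ B₂ : S.Bd} (a : P.Hilb B₁ B₂) {d : P.Hilb B B →L[ℂ] P.Hilb B B}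
    (hd : d ∈ P.vonNeumannR B) :
    P.PhiR B₁ B d ∘L P.psiL B B₁ B₂ a = P.psiL B B₁ B₂ a ∘L P.PhiR B₂ B d := by
  refine (P.denseRange_ket B₁ B₂).induction_on a (isClosed_eq (by fun_prop) (by fun_prop))
    fun a => P.clm_ext_cylF_right fun ε χ => ?_
  simp only [ContinuousLinearMap.comp_apply, psiL_ket, glueL_ket, ← glueF_assoc,
    P.isPhiR_PhiR _ B hd ε]
  rw [← glueL_comp_glueL, ContinuousLinearMap.comp_apply]

/-! ### The involution and the adjoint. -/

variable (B)

/-- Both sides are continuous in `a`, so the adjoint formula for states decides. -/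
theorem psiR_starH {B₁ B₂ : S.Bd} (a : P.Hilb B₁ B₂) :
    P.psiR B B₂ B₁ (P.starH a) = ContinuousLinearMap.adjoint (P.psiR B B₁ B₂ a) := by
  refine (P.denseRange_ket B₁ B₂).induction_on a (isClosed_eq (by fun_prop)
    (ContinuousLinearMap.adjoint.continuous.comp (by fun_prop))) fun a => ?_
  rw [starH_ket, psiR_ket, psiR_ket, adjoint_glueR]

theorem psiL_starH {B₁ B₂ : S.Bd} (a : P.Hilb B₁ B₂) :
    P.psiL B B₂ B₁ (P.starH a) = ContinuousLinearMap.adjoint (P.psiL B B₁ B₂ a) := by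
  refine (P.denseRange_ket B₁ B₂).induction_on a (isClosed_eq (by fun_prop)
    (ContinuousLinearMap.adjoint.continuous.comp (by fun_prop))) fun a => ?_
  rw [starH_ket, psiL_ket, psiL_ket, adjoint_glueL]

end PathIntegral

theorem mainTheorem9 (S : SourceManifolds) (P : PathIntegral S) :
    -- `Φ^L` and `Φ^R` are well defined on the von Neumann algebras
    (∀ (B B' : S.Bd), ∀ d ∈ P.vonNeumannL B, P.IsPhiL B B' d (P.PhiL B B' d) ∧
      ∀ T, P.IsPhiL B B' d T → T = P.PhiL B B' d) ∧
    (∀ (B B' : S.Bd), ∀ d ∈ P.vonNeumannR B', P.IsPhiR B B' d (P.PhiR B B' d) ∧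
      ∀ T, P.IsPhiR B B' d T → T = P.PhiR B B' d) ∧
    ∃ (ΨR : ∀ B B₁ B₂ : S.Bd, P.Hilb B₁ B₂ → (P.Hilb B B₁ →L[ℂ] P.Hilb B B₂))
      (ΨL : ∀ B₁ B₂ B : S.Bd, P.Hilb B₁ B₂ → (P.Hilb B₂ B →L[ℂ] P.Hilb B₁ B)),
      -- the right map: existence, uniqueness, intertwining
      (∀ B B₁ B₂ : S.Bd, P.IsRightGluing B B₁ B₂ (ΨR B B₁ B₂) ∧
        ∀ Ψ, P.IsRightGluing B B₁ B₂ Ψ → Ψ = ΨR B B₁ B₂) ∧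
      (∀ (B B₁ B₂ : S.Bd) (a : P.Hilb B₁ B₂), ∀ d ∈ P.vonNeumannL B,
        P.PhiL B B₂ d ∘L ΨR B B₁ B₂ a = ΨR B B₁ B₂ a ∘L P.PhiL B B₁ d) ∧
      -- the left map: existence, uniqueness, intertwining
      (∀ B₁ B₂ B : S.Bd, P.IsLeftGluing B₁ B₂ B (ΨL B₁ B₂ B) ∧
        ∀ Ψ, P.IsLeftGluing B₁ B₂ B Ψ → Ψ = ΨL B₁ B₂ B) ∧
      (∀ (B₁ B₂ B : S.Bd) (a : P.Hilb B₁ B₂), ∀ d ∈ P.vonNeumannR B,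
        P.PhiR B₁ B d ∘L ΨL B₁ B₂ B a = ΨL B₁ B₂ B a ∘L P.PhiR B₂ B d) ∧
      -- the involution `⋆` corresponds to the adjoint
      (∀ (B B₁ B₂ : S.Bd) (a : P.Hilb B₁ B₂),
        ΨR B B₂ B₁ (P.starH a) = ContinuousLinearMap.adjoint (ΨR B B₁ B₂ a)) ∧
      (∀ (B₁ B₂ B : S.Bd) (a : P.Hilb B₁ B₂),
        ΨL B₂ B₁ B (P.starH a) = ContinuousLinearMap.adjoint (ΨL B₁ B₂ B a)) := by
  refine ⟨fun B B' d hd => ⟨P.isPhiL_PhiL B B' hd, fun T hT => P.clm_ext_cylF_left fun ε χ =>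
      (hT ε χ).trans (P.isPhiL_PhiL B B' hd ε χ).symm⟩,
    fun B B' d hd => ⟨P.isPhiR_PhiR B B' hd, fun T hT => P.clm_ext_cylF_right fun ε χ =>
      (hT ε χ).trans (P.isPhiR_PhiR B B' hd ε χ).symm⟩,
    fun B B₁ B₂ => P.psiR B B₁ B₂, fun B₁ B₂ B => P.psiL B B₁ B₂,
    fun B B₁ B₂ => ⟨P.isRightGluing_psiR B B₁ B₂, fun Ψ h =>
      P.eq_of_pointwise_continuous h.1 (P.isRightGluing_psiR B B₁ B₂).1 fun a b =>
        (h.2 a b).trans ((P.isRightGluing_psiR B B₁ B₂).2 a b).symm⟩,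
    fun B B₁ B₂ a d hd => P.PhiL_comp_psiR a hd,
    fun B₁ B₂ B => ⟨P.isLeftGluing_psiL B B₁ B₂, fun Ψ h =>
      P.eq_of_pointwise_continuous h.1 (P.isLeftGluing_psiL B B₁ B₂).1 fun a b =>
        (h.2 a b).trans ((P.isLeftGluing_psiL B B₁ B₂).2 a b).symm⟩,
    fun B₁ B₂ B a d hd => P.PhiR_comp_psiL a hd,
    fun B B₁ B₂ a => P.psiR_starH B a,
    fun B₁ B₂ B a => P.psiL_starH B a⟩
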